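/- Let $q$ be a prime power. For a doubly infinite sequence $T=(t_i)_{i\in\mathbb Z}$ over $\mathbb F_q$ its number wall is the array with entry in row $i$ and column $j$ ($i,j\in\mathbb Z$) $$W_{i,j}(T)=\det\big(t_{j+b-a}\big)_{0\le a,b\le i}\ \text{ if } i\ge 0,\qquad W_{-1,j}(T)=1,\qquad W_{i,j}(T)=0\ \text{ if } i<-1 .$$ The number wall of a finite sequence $S=(s_1,\dots,s_r)$ consists of the entries $(i,j)$ (row $i$, column $j$) with $i\ge0$, $j-i\ge 1$ and $j+i\le r$; these depend on $s_1,\dots,s_r$ only. Let $r,n,m,l\ge0$ be integers with $l\ge1$ and let $d\in\mathbb Z$ with $d<l$. Let $R^{l,d,n,m}_{q,r}$ be the set of sequences $S$ of length $r$ over $\mathbb F_q$ whose number wall has a (possibly incomplete) zero portion containing the rectangle of horizontal length $l$ and height $l-d$ with top left corner in row $m$ and column $n$; that is, $S$ extends to a doubly infinite sequence over $\mathbb F_q$ all of whose number wall entries in rows $m,\dots,m+l-d-1$ and columns $n,\dots,n+l-1$ vanish. (If the rectangle lies on the number wall of $S$, this says that the entries of the wall of $S$ on the rectangle vanish.) Assume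 that at least one of the longest sides of the rectangle (the top and bottom rows if $d\ge0$, the left and right columns if $d\le0$) is contained fully in the number wall of a sequence of length $r$. Then: 1. If $d\le 0$, $$\#R^{l,d,n,m}_{q,r}=\frac{q^{r-(l-d)-2m-1}}{q+1}\Big((-d+1)q^{2m+2}-(-d-1)q^{2m+1}-d(q-1)\Big).$$ 2. If $0\le d\le m$, $$\#R^{l,d,n,m}_{q,r}=\frac{q^{r-l-2m}}{(q+1)^2}\Big((d+1)q^{2m+2}+2q^{2m+1}-(d-1)q^{2m}-q^{2d}+1\Big).$$ 3. If $d>m$, then the formula of part 2 holds with $d$ replaced by $m$ on the right-hand side. Consequently, there is a constant $C>0$ depending only on $q$ such that, for all such $r,n,m,l,d$, $$\#R^{l,d,n,m}_{q,r}\le C\cdot\max(1,|d|)\cdot q^{\,r-\max(l,\,l-d)} .$$ In particular $\#R^{l,d,n,m}_{q,r}\ll_q\max(1,|d|)\,q^{r-l}$. -/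

import Mathlib

universe u

/-- The `(m+1) × (v+1)` Toeplitz matrix of the doubly infinite sequence `S` whose top left entry
is `S n`: first row `S n, S (n+1), …, S (n+v)`, first column `S n, S (n-1), …, S (n-m)`. -/
def toeplitzMatrix {F : Type*} (S : ℤ → F) (n : ℤ) (m v : ℕ) :
    Matrix (Fin (m + 1)) (Fin (v + 1)) F :=
  Matrix.of fun i j => S (n + (j : ℤ) - (i : ℤ))

/-- The entry in row `m` and column `n` of the number wall of a doubly infinite sequence. -/
def numberWall {F : Type*} [Field F] (S : ℤ → F) (m n : ℤ) : F :=
  if 0 ≤ m then (toeplitzMatrix S n m.toNat m.toNat).det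
  else if m = -1 then 1
  else 0

/-- The doubly infinite sequence `T` extends the finite sequence `S = (s_1, …, s_r)`, where
`s_i` is stored as `S (i - 1)`. -/
def ExtendsSeq {F : Type*} {r : ℕ} (T : ℤ → F) (S : Fin r → F) : Prop :=
  ∀ i : Fin r, T ((i : ℤ) + 1) = S i

/-- `(i, j)` (row `i`, column `j`) is a position of the finite number wall of a sequence
`s_1, …, s_r`: the Toeplitz matrix of that entry uses precisely the terms
`s_{j-i}, …, s_{j+i}`, all of which have to be terms of the sequence. -/
def OnFiniteWall (r : ℕ) (i j : ℤ) : Prop :=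
  0 ≤ i ∧ 1 ≤ j - i ∧ j + i ≤ r

/-- The positions (row `i`, column `j`) of the rectangle of horizontal length `l` and height
`l - d` whose top left corner is in row `m` and column `n`. -/
def InRect (l : ℕ) (d : ℤ) (n m : ℕ) (i j : ℤ) : Prop :=
  (m : ℤ) ≤ i ∧ i < m + (l - d) ∧ (n : ℤ) ≤ j ∧ j < n + l

/-- The number wall of the finite sequence `S` has a (possibly incomplete) zero portion containing
the rectangle of horizontal length `l`, height `l - d` and top left corner in row `m`, column `n`.
Part of the rectangle may stick out of the finite (triangular) number wall of `S`, so the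
entries are read off from the wall of a doubly infinite sequence extending `S`. -/
def HasZeroRect {F : Type*} [Field F] {r : ℕ} (S : Fin r → F)
    (l : ℕ) (d : ℤ) (n m : ℕ) : Prop :=
  ∃ T : ℤ → F, ExtendsSeq T S ∧ ∀ i j : ℤ, InRect l d n m i j → numberWall T i j = 0

/-- The set of sequences of length `r` over `F` whose number wall has zeros on the rectangle of
horizontal length `l`, height `l - d` and top left corner in row `m` and column `n`. -/
def rectSeqs (F : Type*) [Field F] (r l : ℕ) (d : ℤ) (n m : ℕ) : Set (Fin r → F) :=
  {S | HasZeroRect S l d n m}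

/-- At least one of the longest sides of the rectangle lies entirely on the number wall of a
sequence of length `r`. The horizontal sides are longest when `0 ≤ d`, the vertical sides are
longest when `d ≤ 0`. -/
def LongestSideOnWall (r l : ℕ) (d : ℤ) (n m : ℕ) : Prop :=
  (0 ≤ d ∧
    ((∀ j : ℤ, (n : ℤ) ≤ j → j < n + l → OnFiniteWall r m j) ∨
     (∀ j : ℤ, (n : ℤ) ≤ j → j < n + l → OnFiniteWall r (m + (l - d) - 1) j))) ∨
  (d ≤ 0 ∧
    ((∀ i : ℤ, (m : ℤ) ≤ i → i < m + (l - d) → OnFiniteWall r i n) ∨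
     (∀ i : ℤ, (m : ℤ) ≤ i → i < m + (l - d) → OnFiniteWall r i (n + l - 1))))

/-- On positions of the finite number wall, entries do not depend on the chosen extension. -/
theorem numberWall_eq_of_extendsSeq {F : Type*} [Field F] {r : ℕ} {S : Fin r → F}
    {T T' : ℤ → F} (hT : ExtendsSeq T S) (hT' : ExtendsSeq T' S) {i j : ℤ}
    (h : OnFiniteWall r i j) : numberWall T i j = numberWall T' i j := by
  obtain ⟨h0, h1, h2⟩ := h
  have key : toeplitzMatrix T j i.toNat i.toNat = toeplitzMatrix T' j i.toNat i.toNat := by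
    ext a b
    simp only [toeplitzMatrix, Matrix.of_apply]
    have ha := a.isLt
    have hb := b.isLt
    have hk : (j + (b : ℤ) - (a : ℤ) - 1).toNat < r := by omega
    have e : j + (b : ℤ) - (a : ℤ)
        = (((⟨_, hk⟩ : Fin r) : ℕ) : ℤ) + 1 := by
      simp only
      omega
    rw [e]
    exact (hT ⟨_, hk⟩).trans (hT' ⟨_, hk⟩).symm
  simp only [numberWall, key]

/-- If the whole rectangle lies on the finite number wall, `HasZeroRect` says literally that the
entries of the wall on the rectangle vanish, whichever extension is used to compute them. -/
theorem hasZeroRect_iff_of_onFiniteWall {F : Type*} [Field F] {r : ℕ} {S : Fin r → F}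
    {l : ℕ} {d : ℤ} {n m : ℕ} (h : ∀ i j : ℤ, InRect l d n m i j → OnFiniteWall r i j)
    {T : ℤ → F} (hT : ExtendsSeq T S) :
    HasZeroRect S l d n m ↔ ∀ i j : ℤ, InRect l d n m i j → numberWall T i j = 0 := by
  constructor
  · rintro ⟨T', hT', hz⟩ i j hij
    rw [numberWall_eq_of_extendsSeq hT hT' (h i j hij)]
    exact hz i j hij
  · intro hz
    exact ⟨T, hT, hz⟩

/-! Read a kernel vector of a Toeplitz matrix as the coefficients of a polynomial in the shift: a
wall entry in row `m` vanishes iff a nonzero polynomial of degree at most `m` annihilates `T` on an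
interval of `m + 1` places. `Annihilated` is the analogue for squares. Since such polynomials
commute, two of them with overlapping intervals constrain each other's degrees, which makes zeros
fill squares: a zero diagonal fills its square (`annihilated_of_diagonal`), and a zero rectangle
lies in a zero square on its longer side (`exists_annihilated_of_tall`,
`exists_annihilated_of_wide`).

Hence the set to be counted is a union of `|d| + 1` sets of sequences, one for each position of the
square; for `d > m` only `m + 1` positions remain, as no zero square starts above row `0`, and this
gives part 3. Each position has `q ^ (r - l')` sequences, `l'` being the side (`ncard_squareSeqs`),
so the union bound yields the final estimate. For the exact count, squares are added one at a time:
a new one meets the earlier ones only where it meets its neighbour (`tallSeqs_inter`,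
`wideSeqs_inter`). Two neighbouring squares form a rectangle with sides differing by one, which
again is a union of two squares, and the resulting recursion climbs to row `0`. -/

open Polynomial

/-! ### Polynomials acting through the shift -/

/-- The polynomial `c` in the shift operator applied to the sequence `T`, at position `x`. -/
noncomputable def shiftAct {F : Type*} [Field F] (c : F[X]) : (ℤ → F) →ₗ[F] (ℤ → F) :=
  aeval (LinearMap.funLeft F F (fun x : ℤ => x + 1)) c

section Algebra

variable {F : Type*} [Field F]

theorem shift_pow_apply (k : ℕ) (T : ℤ → F) (x : ℤ) :
    ((LinearMap.funLeft F F (fun x : ℤ => x + 1)) ^ k) T x = T (x + k) := by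
  induction k generalizing x with
  | zero => simp
  | succ k ih =>
    rw [pow_succ', Module.End.mul_apply, LinearMap.funLeft_apply, ih]
    congr 1; push_cast; ring

theorem shiftAct_apply {c : F[X]} {N : ℕ} (hN : c.natDegree < N) (T : ℤ → F) (x : ℤ) :
    shiftAct c T x = ∑ i ∈ Finset.range N, c.coeff i * T (x + i) := by
  rw [shiftAct, aeval_eq_sum_range' hN, LinearMap.sum_apply, Finset.sum_apply]
  simp [shift_pow_apply]

theorem shiftAct_comm (c d : F[X]) (T : ℤ → F) :
    shiftAct c (shiftAct d T) = shiftAct d (shiftAct c T) := by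
  simp only [shiftAct, ← Module.End.mul_apply, ← map_mul, mul_comm c d]

theorem shiftAct_X_pow_mul (k : ℕ) (c : F[X]) (T : ℤ → F) (x : ℤ) :
    shiftAct (X ^ k * c) T x = shiftAct c T (x + k) := by
  rw [shiftAct, map_mul, Module.End.mul_apply, map_pow, aeval_X, shift_pow_apply]; rfl

theorem shiftAct_congr {c : F[X]} {T T' : ℤ → F} {x : ℤ}
    (h : ∀ y, x ≤ y → y ≤ x + c.natDegree → T y = T' y) : shiftAct c T x = shiftAct c T' x := by
  rw [shiftAct_apply (Nat.lt_succ_self _), shiftAct_apply (Nat.lt_succ_self _)]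
  refine Finset.sum_congr rfl fun i hi => ?_
  rw [h _ (by omega) (by simp at hi; omega)]

theorem shiftAct_eq_single {c : F[X]} {f : ℤ → F} {x : ℤ} {k : ℕ}
    (h : ∀ i, c.natTrailingDegree ≤ i → i ≤ c.natDegree → i ≠ k → f (x + i) = 0) :
    shiftAct c f x = c.coeff k * f (x + k) := by
  rw [shiftAct_apply (show c.natDegree < max (c.natDegree + 1) (k + 1) by omega),
    Finset.sum_eq_single k]
  · intro i _ hik
    by_cases h1 : i < c.natTrailingDegree
    · rw [coeff_eq_zero_of_lt_natTrailingDegree h1, zero_mul]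
    by_cases h2 : c.natDegree < i
    · rw [coeff_eq_zero_of_natDegree_lt h2, zero_mul]
    rw [h i (by omega) (by omega) hik, mul_zero]
  · intro h; simp at h

theorem shiftAct_eq_zero {c : F[X]} {f : ℤ → F} {x : ℤ}
    (h : ∀ y, x + c.natTrailingDegree ≤ y → y ≤ x + c.natDegree → f y = 0) :
    shiftAct c f x = 0 := by
  -- The exceptional index is put just above the degree, where the coefficient is zero.
  rw [shiftAct_eq_single (k := c.natDegree + 1) (fun i h1 h2 _ => h _ (by omega) (by omega)),
    coeff_eq_zero_of_natDegree_lt (Nat.lt_succ_self _), zero_mul]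

/-- If `c` annihilates `T` just before `y` but not at `y`, then a second polynomial `d` cannot
annihilate `T` on a whole window determined by the degrees. -/
theorem not_annihilates_of_ne_zero_right {c d : F[X]} (hd : d ≠ 0) {T : ℤ → F} {y : ℤ}
    (hy : shiftAct c T y ≠ 0)
    (hc : ∀ x, y - d.natDegree ≤ x → x < y → shiftAct c T x = 0) :
    ¬ ∀ x, y - d.natDegree ≤ x → x ≤ y - d.natDegree + c.natDegree → shiftAct d T x = 0 := by
  intro h
  have h1 : shiftAct c (shiftAct d T) (y - d.natDegree) = 0 :=
    shiftAct_eq_zero fun x h1 h2 => h x (by omega) h2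
  rw [shiftAct_comm, shiftAct_eq_single (k := d.natDegree)
    (fun i _ h2 h3 => hc _ (by omega) (by omega)), sub_add_cancel] at h1
  exact mul_ne_zero (by simpa using hd) hy h1

/-- The mirror image of `not_annihilates_of_ne_zero_right`. -/
theorem not_annihilates_of_ne_zero_left {c d : F[X]} (hd : d ≠ 0) {T : ℤ → F} {y : ℤ}
    (hy : shiftAct c T y ≠ 0)
    (hc : ∀ x, y < x → x ≤ y - d.natTrailingDegree + d.natDegree → shiftAct c T x = 0) :
    ¬ ∀ x, y - d.natTrailingDegree + c.natTrailingDegree ≤ x →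
      x ≤ y - d.natTrailingDegree + c.natDegree → shiftAct d T x = 0 := by
  intro h
  have h1 : shiftAct c (shiftAct d T) (y - d.natTrailingDegree) = 0 :=
    shiftAct_eq_zero fun x h1 h2 => h x (by omega) h2
  rw [shiftAct_comm, shiftAct_eq_single (k := d.natTrailingDegree)
    (fun i _ h2 h3 => hc _ (by omega) (by omega)), sub_add_cancel] at h1
  exact mul_ne_zero (by simpa [coeff_natTrailingDegree_eq_zero] using hd) hy h1

/-! ### Zero squares and annihilating polynomials -/

/-- A nonzero polynomial of degree at most `m` in the shift annihilates `T` on `[n - m, n + l)`.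
This says that the number wall of `T` vanishes on the `l × l` square with top left corner in row
`m` and column `n`. -/
def Annihilated (T : ℤ → F) (m : ℕ) (n : ℤ) (l : ℕ) : Prop :=
  ∃ c : F[X], c ≠ 0 ∧ c.natDegree ≤ m ∧ ∀ x : ℤ, n - m ≤ x → x < n + l → shiftAct c T x = 0

theorem Annihilated.congr {T T' : ℤ → F} {m l : ℕ} {n : ℤ} (h : Annihilated T m n l)
    (hT : ∀ y, n - m ≤ y → y < n + l + m → T y = T' y) : Annihilated T' m n l := by
  obtain ⟨c, hc, hm, h⟩ := h
  refine ⟨c, hc, hm, fun x h1 h2 => ?_⟩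
  rw [← h x h1 h2]
  exact (shiftAct_congr fun y h3 h4 => hT y (by omega) (by omega)).symm

theorem Annihilated.subsquare {T : ℤ → F} {m l m' l' : ℕ} {n n' : ℤ} (h : Annihilated T m n l)
    (h1 : m ≤ m') (h2 : m' + l' ≤ m + l) (h3 : n ≤ n')
    (h4 : n' + l' ≤ n + l) : Annihilated T m' n' l' := by
  obtain ⟨c, hc, hm, h⟩ := h
  -- `b` is the amount by which the new left end `n' - m'` falls short of `n - m`; a factor `X ^ b`
  -- shifts the evaluation points right by it.
  obtain ⟨b, hb⟩ : ∃ b : ℕ, b = max 0 (((m' : ℤ) - m) - (n' - n)) :=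
    ⟨_, Int.toNat_of_nonneg (by omega)⟩
  refine ⟨X ^ b * c, mul_ne_zero (pow_ne_zero _ X_ne_zero) hc, ?_, fun x h5 h6 => ?_⟩
  · rw [natDegree_X_pow_mul _ hc]; omega
  · rw [shiftAct_X_pow_mul]
    exact h _ (by omega) (by omega)

theorem numberWall_eq_zero_iff (T : ℤ → F) (m : ℕ) (n : ℤ) :
    numberWall T m n = 0 ↔ Annihilated T m n 1 := by
  rw [numberWall, if_pos (by omega), ← Matrix.exists_mulVec_eq_zero_iff]
  simp only [Int.toNat_natCast]
  have key : ∀ (c : F[X]), c.natDegree ≤ m → ∀ i : Fin (m + 1),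
      (toeplitzMatrix T n m m).mulVec (fun j => c.coeff j) i = shiftAct c T (n - i) := by
    intro c hc i
    rw [shiftAct_apply (Nat.lt_succ_of_le hc), Matrix.mulVec, dotProduct,
      Finset.sum_range]
    refine Finset.sum_congr rfl fun j _ => ?_
    rw [toeplitzMatrix, Matrix.of_apply, mul_comm]
    congr 2; ring
  constructor
  · rintro ⟨v, hv, h⟩
    let e := (degreeLTEquiv F (m + 1)).symm v
    have hdeg : (e : F[X]).natDegree ≤ m := by
      have := mem_degreeLT.1 e.2
      exact natDegree_le_iff_coeff_eq_zero.2 fun N hN =>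
        coeff_eq_zero_of_degree_lt (this.trans_le (by exact_mod_cast hN))
    have hcoe : (fun j : Fin (m + 1) => (e : F[X]).coeff j) = v :=
      (degreeLTEquiv F (m + 1)).apply_symm_apply v
    refine ⟨e, fun h0 => hv ?_, hdeg, fun x h1 h2 => ?_⟩
    · rw [← hcoe, h0]; ext; simp
    · have := key e hdeg ⟨(n - x).toNat, by omega⟩
      rw [hcoe, h] at this
      rw [show x = n - ((n - x).toNat : ℤ) by push_cast at h2; omega]
      exact this.symm
  · rintro ⟨c, hc, hm, h⟩
    refine ⟨fun j => c.coeff j, fun h0 => hc ?_, ?_⟩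
    · ext i
      by_cases hi : i < m + 1
      · exact congrFun h0 ⟨i, hi⟩
      · rw [coeff_eq_zero_of_natDegree_lt (by omega), coeff_zero]
    · ext i
      rw [key c hm, h _ (by omega) (by push_cast; omega), Pi.zero_apply]

/-- If the polynomial `c` of the shorter diagonal fails at the next place, the polynomial `v` of the
last diagonal entry cannot have degree above `m`, by commutation with `c`; then `v` itself serves
the whole square. -/
theorem annihilated_of_diagonal {T : ℤ → F} {m l : ℕ} {n : ℤ}
    (h : ∀ k, k < l + 1 → Annihilated T (m + k) (n + k) 1) : Annihilated T m n (l + 1) := by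
  induction l with
  | zero => simpa using h 0 (by omega)
  | succ l ih =>
    obtain ⟨c, hc, hcm, hc'⟩ := ih fun k hk => h k (by omega)
    obtain ⟨v, hv, hvm, hv'⟩ := h (l + 1) (by omega)
    push_cast at hc' hv'
    by_cases hy : shiftAct c T (n + (l + 1)) = 0
    · refine ⟨c, hc, hcm, fun x h1 h2 => ?_⟩
      push_cast at h2
      rcases eq_or_ne x (n + (l + 1)) with rfl | hx
      · exact hy
      · exact hc' x h1 (by omega)
    · by_cases hd : v.natDegree ≤ m
      · exact ⟨v, hv, hd, fun x h1 h2 => hv' x (by omega) (by push_cast at h2; omega)⟩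
      · exact absurd (fun x h1 h2 => hv' x (by omega) (by omega))
          (not_annihilates_of_ne_zero_right hv hy fun x h1 h2 => hc' x (by omega) (by omega))

/-- Let `c` serve the upper and `d` the lower starting rows. If `c` extends by one place at neither
end, the failure on the right bounds the degree of `d` from above and the failure on the left bounds
its order at `0` from below. So `d`, after division by a power of `X` if `k ≥ j`, has degree below
that of `c` and an interval in the right place. -/
theorem exists_annihilated_of_tall {T : ℤ → F} {m w δ : ℕ} {n : ℤ} (hw : 0 < w)
    (h : ∀ i ≤ δ, Annihilated T (m + i) n w) :
    ∃ j ≤ δ, Annihilated T m (n - j) (w + δ) := by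
  induction δ generalizing m with
  | zero => exact ⟨0, le_rfl, by simpa using h 0 le_rfl⟩
  | succ δ ih =>
    obtain ⟨j, hj, c, hc, hcm, hc'⟩ := ih fun i hi => h i (by omega)
    obtain ⟨k, hk, d, hd, hdm, hd'⟩ := ih (m := m + 1) fun i hi => by
      have := h (i + 1) (by omega)
      rwa [show m + (i + 1) = m + 1 + i by omega] at this
    push_cast at hc' hd'
    by_cases hr : shiftAct c T (n - j + (w + δ)) = 0
    · refine ⟨j, by omega, c, hc, hcm, fun x h1 h2 => ?_⟩
      push_cast at h2
      rcases eq_or_ne x (n - j + (w + δ)) with rfl | hx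
      · exact hr
      · exact hc' x h1 (by omega)
    by_cases hl : shiftAct c T (n - j - m - 1) = 0
    · refine ⟨j + 1, by omega, c, hc, hcm, fun x h1 h2 => ?_⟩
      push_cast at h1 h2
      rcases eq_or_ne x (n - j - m - 1) with rfl | hx
      · exact hl
      · exact hc' x (by omega) (by omega)
    have hdeg : (d.natDegree : ℤ) ≤ c.natDegree + (k - j) := by
      by_contra hlt
      exact not_annihilates_of_ne_zero_right hd hr
        (fun x h1 h2 => hc' x (by omega) (by omega)) fun x h1 h2 => hd' x (by omega) (by omega)
    have hval : (k - j : ℤ) + 1 ≤ d.natTrailingDegree := by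
      by_contra hlt
      exact not_annihilates_of_ne_zero_left hd hl
        (fun x h1 h2 => hc' x (by omega) (by omega)) fun x h1 h2 => hd' x (by omega) (by omega)
    rcases lt_or_ge k j with hkj | hkj
    · refine ⟨k + 1, by omega, d, hd, by omega, fun x h1 h2 => hd' x ?_ ?_⟩ <;>
        push_cast at h1 h2 ⊢ <;> omega
    · obtain ⟨e, he⟩ := X_pow_dvd_iff.2 fun i (hi : i < k - j + 1) =>
        coeff_eq_zero_of_lt_natTrailingDegree (p := d) (by omega)
      have he0 : e ≠ 0 := by rintro rfl; exact hd (by simpa using he)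
      have hde := natDegree_X_pow_mul (k - j + 1) he0
      rw [← he] at hde
      refine ⟨j, by omega, e, he0, by omega, fun x h1 h2 => ?_⟩
      have := hd' (x - (k - j + 1 : ℕ)) (by push_cast; omega) (by push_cast at h2 ⊢; omega)
      rwa [he, shiftAct_X_pow_mul, sub_add_cancel] at this

/-- The same exchange for columns: `c` serves the left ones and `e` the right ones. If `c` fails on
the right and `e` on the left, then `e` has smaller degree than `c`, and `c` has a large order at
`0`; one of `e` and `c` divided by a power of `X` serves a square that starts higher up. -/
theorem exists_annihilated_of_wide {T : ℤ → F} {m h d : ℕ} {n : ℤ} (hh : 0 < h)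
    (H : ∀ i ≤ d, Annihilated T m (n + i) h) :
    ∃ i ≤ d, i ≤ m ∧ Annihilated T (m - i) n (h + d) := by
  induction d generalizing n with
  | zero => exact ⟨0, le_rfl, by omega, by simpa using H 0 le_rfl⟩
  | succ d ih =>
    obtain ⟨j, hj, hjm, hA⟩ := ih fun i hi => H i (by omega)
    obtain ⟨k, hk, hkm, hB⟩ := ih (n := n + 1) fun i hi => by
      have := H (i + 1) (by omega)
      rwa [show n + ((i + 1 : ℕ) : ℤ) = n + 1 + i by push_cast; ring] at this
    obtain ⟨M, hM⟩ : ∃ M, M = m - j := ⟨_, rfl⟩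
    obtain ⟨M', hM'⟩ : ∃ M', M' = m - k := ⟨_, rfl⟩
    rw [← hM] at hA
    rw [← hM'] at hB
    suffices ∃ N, N ≤ m ∧ m ≤ N + d + 1 ∧ Annihilated T N n (h + d + 1) by
      obtain ⟨N, h1, h2, h3⟩ := this
      exact ⟨m - N, by omega, by omega, by rwa [show m - (m - N) = N by omega]⟩
    obtain ⟨c, hc, hcm, hc'⟩ := hA
    obtain ⟨e, he, hem, he'⟩ := hB
    push_cast at hc' he'
    by_cases hr : shiftAct c T (n + (h + d)) = 0
    · refine ⟨M, by omega, by omega, c, hc, hcm, fun x h1 h2 => ?_⟩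
      push_cast at h2
      rcases eq_or_ne x (n + (h + d)) with rfl | hx
      · exact hr
      · exact hc' x h1 (by omega)
    by_cases hl : shiftAct e T (n - M') = 0
    · refine ⟨M', by omega, by omega, e, he, hem, fun x h1 h2 => ?_⟩
      push_cast at h2
      rcases eq_or_ne x (n - M') with rfl | hx
      · exact hl
      · exact he' x (by omega) (by omega)
    have hdeg : e.natDegree < c.natDegree := by
      by_contra hlt
      exact not_annihilates_of_ne_zero_right he hr
        (fun x h1 h2 => hc' x (by omega) (by omega)) fun x h1 h2 => he' x (by omega) (by omega)
    have hval : (e.natTrailingDegree : ℤ) + M + 1 ≤ c.natTrailingDegree + M' := by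
      by_contra hlt
      exact not_annihilates_of_ne_zero_left hc hl
        (fun x h1 h2 => he' x (by omega) (by omega)) fun x h1 h2 => hc' x (by omega) (by omega)
    rcases le_or_gt M M' with hMM | hMM
    · refine ⟨M - 1, by omega, by omega, e, he, by omega, fun x h1 h2 => he' x ?_ ?_⟩ <;>
        push_cast at h1 h2 ⊢ <;> omega
    · obtain ⟨g, hg⟩ := X_pow_dvd_iff.2 fun i (hi : i < M - M' + 1) =>
        coeff_eq_zero_of_lt_natTrailingDegree (p := c) (by omega)
      have hg0 : g ≠ 0 := by rintro rfl; exact hc (by simpa using hg)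
      have hdg := natDegree_X_pow_mul (M - M' + 1) hg0
      rw [← hg] at hdg
      refine ⟨M' - 1, by omega, by omega, g, hg0, by omega, fun x h1 h2 => ?_⟩
      have := hc' (x - (M - M' + 1 : ℕ)) (by push_cast; omega) (by push_cast at h2 ⊢; omega)
      rwa [hg, shiftAct_X_pow_mul, sub_add_cancel] at this

end Algebra

/-! ### Counting zero squares by double counting -/

section Counting

variable {F : Type*} [Field F]

/-- The extension by zero of the finite sequence `S = (s_1, …, s_r)`. -/
def zeroExtend (F : Type*) [Field F] (r : ℕ) : (Fin r → F) →ₗ[F] (ℤ → F) where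
  toFun S x := if h : 1 ≤ x ∧ x ≤ r then S ⟨(x - 1).toNat, by omega⟩ else 0
  map_add' S S' := by ext x; by_cases h : 1 ≤ x ∧ x ≤ r <;> simp [h]
  map_smul' a S := by ext x; by_cases h : 1 ≤ x ∧ x ≤ r <;> simp [h]

theorem extendsSeq_zeroExtend {r : ℕ} (S : Fin r → F) : ExtendsSeq (zeroExtend F r S) S := by
  intro i
  have := i.isLt
  rw [zeroExtend, LinearMap.coe_mk, AddHom.coe_mk, dif_pos (by omega)]
  congr 1; ext; simp

theorem ExtendsSeq.eq_zeroExtend {r : ℕ} {S : Fin r → F} {T : ℤ → F} (h : ExtendsSeq T S) {x : ℤ}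
    (h1 : 1 ≤ x) (h2 : x ≤ r) : T x = zeroExtend F r S x := by
  have e : x = (((⟨(x - 1).toNat, by omega⟩ : Fin r) : ℕ) : ℤ) + 1 := by simp only; omega
  rw [e, h, extendsSeq_zeroExtend]

theorem zeroExtend_single {r : ℕ} (p : Fin r) (a : F) (x : ℤ) :
    zeroExtend F r (Pi.single p a) x = if x = p + 1 then a else 0 := by
  have := p.isLt
  by_cases h : 1 ≤ x ∧ x ≤ r
  · rw [zeroExtend, LinearMap.coe_mk, AddHom.coe_mk, dif_pos h, Pi.single_apply]
    congr 1
    simp only [Fin.ext_iff, eq_iff_iff]; omega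
  · rw [zeroExtend, LinearMap.coe_mk, AddHom.coe_mk, dif_neg h, if_neg (by omega)]

/-- The conditions are triangular: each one involves a new last term of the sequence, multiplied by
the leading coefficient, so that term can be adjusted without disturbing the earlier conditions. -/
theorem exists_shiftAct_zeroExtend_eq {c : F[X]} (hc : c ≠ 0) {r : ℕ} {a : ℤ} (ha : 1 ≤ a) (k : ℕ)
    (hk : a + k + c.natDegree ≤ r + 1) (y : ℕ → F) :
    ∃ S : Fin r → F, ∀ i < k, shiftAct c (zeroExtend F r S) (a + i) = y i := by
  induction k with
  | zero => exact ⟨0, by simp⟩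
  | succ k ih =>
    obtain ⟨S, hS⟩ := ih (by push_cast at hk; omega)
    push_cast at hk
    let p : Fin r := ⟨(a + k + c.natDegree - 1).toNat, by omega⟩
    have hp : ((p : ℕ) : ℤ) + 1 = a + k + c.natDegree := by simp only [p]; omega
    let b := (y k - shiftAct c (zeroExtend F r S) (a + k)) / c.leadingCoeff
    have key : ∀ i ≤ k, shiftAct c (zeroExtend F r (Pi.single p b)) (a + i) =
        if i = k then c.leadingCoeff * b else 0 := by
      intro i hi
      rw [shiftAct_eq_single (k := c.natDegree), zeroExtend_single, hp]
      · by_cases h : i = k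
        · simp [h]
        · rw [if_neg (by omega), if_neg h, mul_zero]
      · intro j _ hj hj'
        rw [zeroExtend_single, if_neg (by omega)]
    refine ⟨S + Pi.single p b, fun i hi => ?_⟩
    rw [map_add, map_add, Pi.add_apply, key i (by omega)]
    by_cases h : i = k
    · subst h
      rw [if_pos rfl, mul_div_cancel₀ _ (leadingCoeff_ne_zero.2 hc)]; ring
    · rw [if_neg h, add_zero, hS i (by omega)]

/-- The sequences of length `r` annihilated by `c` on `[a, b)`. -/
def annihilatedBy (r : ℕ) (c : F[X]) (a b : ℤ) : Submodule F (Fin r → F) where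
  carrier := {S | ∀ x, a ≤ x → x < b → shiftAct c (zeroExtend F r S) x = 0}
  add_mem' h h' x h1 h2 := by rw [map_add, map_add, Pi.add_apply, h x h1 h2, h' x h1 h2, add_zero]
  zero_mem' x _ _ := by simp
  smul_mem' t S h x h1 h2 := by rw [map_smul, map_smul, Pi.smul_apply, h x h1 h2, smul_zero]

theorem card_annihilatedBy_mul [Fintype F] {c : F[X]} (hc : c ≠ 0) {r k : ℕ} {a b : ℤ}
    (ha : 1 ≤ a) (hb : b = a + k) (hk : b + c.natDegree ≤ r + 1) :
    Nat.card (annihilatedBy r c a b) * Fintype.card F ^ k = Fintype.card F ^ r := by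
  subst hb
  let Φ : (Fin r → F) →ₗ[F] (Fin k → F) :=
    LinearMap.pi fun i => LinearMap.proj (a + (i : ℤ)) ∘ₗ shiftAct c ∘ₗ zeroExtend F r
  have hΦ : ∀ S i, Φ S i = shiftAct c (zeroExtend F r S) (a + (i : ℕ)) := fun S i => rfl
  have hker : LinearMap.ker Φ = annihilatedBy r c a (a + k) := by
    ext S
    rw [LinearMap.mem_ker]
    constructor
    · intro h x h1 h2
      have := congrFun h ⟨(x - a).toNat, by omega⟩
      rw [hΦ] at this
      rw [show x = a + ((x - a).toNat : ℤ) by omega]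
      exact this
    · intro h
      ext i
      exact (hΦ S i).trans (h _ (by omega) (by have := i.isLt; omega))
  have hsurj : Function.Surjective Φ := by
    intro y
    obtain ⟨S, hS⟩ := exists_shiftAct_zeroExtend_eq hc ha k hk
      fun i => if h : i < k then y ⟨i, h⟩ else 0
    refine ⟨S, ?_⟩
    ext i
    rw [hΦ, hS i i.isLt, dif_pos i.isLt]
  have := Φ.finrank_range_add_finrank_ker
  rw [LinearMap.range_eq_top.2 hsurj, finrank_top, Module.finrank_fin_fun,
    Module.finrank_fin_fun, hker] at this
  rw [Module.natCard_eq_pow_finrank (K := F), Nat.card_eq_fintype_card, ← pow_add, add_comm, this]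

/-- The polynomials of degree less than `j` that annihilate `T` on `[a, b)`. -/
def annihilators (T : ℤ → F) (j : ℕ) (a b : ℤ) : Submodule F F[X] where
  carrier := {c | c ∈ degreeLT F j ∧ ∀ x, a ≤ x → x < b → shiftAct c T x = 0}
  add_mem' h h' := ⟨add_mem h.1 h'.1, fun x h1 h2 => by
    simp only [shiftAct] at *
    rw [map_add, LinearMap.add_apply, Pi.add_apply, h.2 x h1 h2, h'.2 x h1 h2, add_zero]⟩
  zero_mem' := ⟨zero_mem _, fun x _ _ => by simp [shiftAct]⟩
  smul_mem' t c h := ⟨Submodule.smul_mem _ t h.1, fun x h1 h2 => by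
    simp only [shiftAct] at *
    rw [map_smul, LinearMap.smul_apply, Pi.smul_apply, h.2 x h1 h2, smul_zero]⟩

theorem shiftAct_sub_smul (c d : F[X]) (t : F) (T : ℤ → F) (x : ℤ) :
    shiftAct (c - t • d) T x = shiftAct c T x - t * shiftAct d T x := by
  simp [shiftAct]

theorem mem_degreeLT_succ_iff {c : F[X]} {m : ℕ} :
    c ∈ degreeLT F (m + 1) ↔ c.natDegree ≤ m := by
  rw [mem_degreeLT, natDegree_le_iff_coeff_eq_zero, degree_lt_iff_coeff_zero]
  exact ⟨fun h N hN => h N hN, fun h N hN => h N hN⟩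

theorem mem_annihilators_iff {T : ℤ → F} {m : ℕ} {a b : ℤ} {c : F[X]}
    (hc : c ∈ annihilators T (m + 1) a b) (hab : a ≤ b) :
    c ∈ annihilators T m a (b + 1) ↔ c.coeff m = 0 ∧ shiftAct c T b = 0 := by
  constructor
  · rintro ⟨h1, h2⟩
    exact ⟨coeff_eq_zero_of_degree_lt (mem_degreeLT.1 h1), h2 b hab (by omega)⟩
  · rintro ⟨h1, h2⟩
    refine ⟨?_, fun x hx hx' => ?_⟩
    · rw [mem_degreeLT, degree_lt_iff_coeff_zero]
      intro N hN
      rcases hN.eq_or_lt with rfl | hN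
      · exact h1
      · exact coeff_eq_zero_of_natDegree_lt ((mem_degreeLT_succ_iff.1 hc.1).trans_lt hN)
    · rcases eq_or_ne x b with rfl | hne
      · exact h2
      · exact hc.2 x hx (by omega)

/-- Unless it is trivial, the space of annihilators loses exactly one dimension when both the
degree bound is lowered by one and the interval is prolonged by one. -/
theorem card_annihilators_succ [Fintype F] {T : ℤ → F} {m : ℕ} {a b : ℤ} (hab : a + m ≤ b)
    (hne : annihilators T (m + 1) a b ≠ ⊥) :
    Nat.card (annihilators T (m + 1) a b) =
      Fintype.card F * Nat.card (annihilators T m a (b + 1)) := by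
  -- By commutation the pairs `(c.coeff m, shiftAct c T b)` are all proportional, so passing to the
  -- smaller space costs at most one dimension.
  have hcross : ∀ c ∈ annihilators T (m + 1) a b, ∀ d ∈ annihilators T (m + 1) a b,
      c.coeff m * shiftAct d T b = d.coeff m * shiftAct c T b := by
    have key : ∀ c ∈ annihilators T (m + 1) a b, ∀ d ∈ annihilators T (m + 1) a b,
        shiftAct c (shiftAct d T) (b - m) = c.coeff m * shiftAct d T b := by
      intro c hc d hd
      have := mem_degreeLT_succ_iff.1 hc.1
      rw [shiftAct_eq_single (k := m) fun i _ h2 h3 => hd.2 _ (by omega) (by omega),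
        sub_add_cancel]
    intro c hc d hd
    rw [← key c hc d hd, ← key d hd c hc, shiftAct_comm]
  obtain ⟨c, hc, hc'⟩ : ∃ c ∈ annihilators T (m + 1) a b, c ∉ annihilators T m a (b + 1) := by
    -- If no dimension were lost, the space would be stable under multiplication by `X`, against the
    -- degree bound.
    by_contra! hall
    obtain ⟨c, hc, hc0⟩ := Submodule.exists_mem_ne_zero_of_ne_bot hne
    have hpow : ∀ i : ℕ, X ^ i * c ∈ annihilators T (m + 1) a b := by
      intro i
      induction i with
      | zero => simpa using hc
      | succ i ih =>
        have h := hall _ ih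
        refine ⟨?_, fun x h1 h2 => ?_⟩
        · rw [pow_succ', mul_assoc, mem_degreeLT_succ_iff, natDegree_X_mul
            (mul_ne_zero (pow_ne_zero _ X_ne_zero) hc0)]
          have := mem_degreeLT.1 h.1
          rwa [← natDegree_lt_iff_degree_lt (mul_ne_zero (pow_ne_zero _ X_ne_zero) hc0)] at this
        · rw [pow_succ', mul_assoc, ← pow_one X, shiftAct_X_pow_mul, pow_one]
          exact h.2 _ (by omega) (by push_cast; omega)
    have := mem_degreeLT_succ_iff.1 (hpow (m + 1)).1
    rw [natDegree_X_pow_mul _ hc0] at this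
    omega
  have hle : annihilators T m a (b + 1) ≤ annihilators T (m + 1) a b := fun d hd =>
    ⟨degreeLT_mono (by omega) hd.1, fun x h1 h2 => hd.2 x h1 (by omega)⟩
  rw [← Nat.card_eq_fintype_card, ← Nat.card_prod]
  symm
  refine Nat.card_congr (Equiv.ofBijective (fun p : F × annihilators T m a (b + 1) =>
    (⟨p.1 • c + p.2, add_mem (Submodule.smul_mem _ _ hc) (hle p.2.2)⟩ :
      annihilators T (m + 1) a b)) ⟨?_, ?_⟩)
  · rintro ⟨s, d, hd⟩ ⟨t, e, he⟩ h
    have h : s • c + d = t • c + e := congrArg Subtype.val h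
    have hst : s = t := by
      by_contra hst
      have h2 : (s - t) • c ∈ annihilators T m a (b + 1) := by
        rw [sub_smul, show s • c - t • c = e - d by linear_combination h]
        exact sub_mem he hd
      exact hc' ((Submodule.smul_mem_iff _ (sub_ne_zero.2 hst)).1 h2)
    subst hst
    simpa using h
  · rintro ⟨d, hd⟩
    suffices ∃ t : F, d - t • c ∈ annihilators T m a (b + 1) by
      obtain ⟨t, ht⟩ := this
      exact ⟨(t, ⟨_, ht⟩), by simp⟩
    have hmem : ∀ t : F, d - t • c ∈ annihilators T (m + 1) a b := fun t =>
      sub_mem hd (Submodule.smul_mem _ _ hc)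
    simp only [fun t => mem_annihilators_iff (hmem t) (by omega), shiftAct_sub_smul, coeff_sub,
      coeff_smul, smul_eq_mul]
    have hx := hcross c hc d hd
    rw [mem_annihilators_iff hc (by omega)] at hc'
    by_cases h0 : c.coeff m = 0
    · have h1 : shiftAct c T b ≠ 0 := fun h => hc' ⟨h0, h⟩
      have h2 : d.coeff m = 0 := by simpa [h0, h1] using hx.symm
      exact ⟨shiftAct d T b / shiftAct c T b, by simp [h0, h2], by field_simp; ring⟩
    · refine ⟨d.coeff m / c.coeff m, by field_simp; ring, ?_⟩
      field_simp
      linear_combination hx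

theorem annihilated_iff_annihilators_ne_bot {T : ℤ → F} {m l : ℕ} {n : ℤ} :
    Annihilated T m n l ↔ annihilators T (m + 1) (n - m) (n + l) ≠ ⊥ := by
  rw [Submodule.ne_bot_iff]
  constructor
  · rintro ⟨c, h1, h2, h3⟩
    exact ⟨c, ⟨mem_degreeLT_succ_iff.2 h2, h3⟩, h1⟩
  · rintro ⟨c, ⟨h2, h3⟩, h1⟩
    exact ⟨c, h1, mem_degreeLT_succ_iff.1 h2, h3⟩

theorem finite_degreeLT [Finite F] (j : ℕ) : Finite (degreeLT F j) :=
  Finite.of_equiv _ (degreeLTEquiv F j).toEquiv.symm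

theorem card_degreeLT [Fintype F] (j : ℕ) : Nat.card (degreeLT F j) = Fintype.card F ^ j := by
  rw [Nat.card_congr (degreeLTEquiv F j).toEquiv]; simp

/-- Double counting of the pairs of a sequence and an annihilator. -/
theorem sum_card_annihilators [Fintype F] {r j k : ℕ} {a b : ℤ} (ha : 1 ≤ a) (hb : b = a + k)
    (hj : b + j ≤ r + 2) :
    ∑ S : Fin r → F, (Nat.card (annihilators (zeroExtend F r S) j a b) : ℚ) =
      (Fintype.card F : ℚ) ^ r + ((Fintype.card F : ℚ) ^ j - 1) *
        (Fintype.card F : ℚ) ^ ((r : ℤ) - k) := by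
  classical
  have := finite_degreeLT (F := F) j
  have := Fintype.ofFinite (degreeLT F j)
  have hq : (Fintype.card F : ℚ) ≠ 0 := by simp
  have h1 : ∀ S : Fin r → F, (Nat.card (annihilators (zeroExtend F r S) j a b) : ℚ) =
      ∑ c : degreeLT F j, if S ∈ annihilatedBy r (c : F[X]) a b then 1 else 0 := by
    intro S
    rw [Finset.sum_boole, ← Fintype.card_subtype, ← Nat.card_eq_fintype_card]
    congr 1
    exact Nat.card_congr
      ⟨fun c => ⟨⟨c.1, c.2.1⟩, c.2.2⟩, fun c => ⟨c.1.1, c.1.2, c.2⟩, fun c => rfl, fun c => rfl⟩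
  have h2 : ∀ c : degreeLT F j, (∑ S : Fin r → F,
      if S ∈ annihilatedBy r (c : F[X]) a b then (1 : ℚ) else 0) =
      if c = 0 then (Fintype.card F : ℚ) ^ r else (Fintype.card F : ℚ) ^ ((r : ℤ) - k) := by
    intro c
    rw [Finset.sum_boole, ← Fintype.card_subtype, ← Nat.card_eq_fintype_card]
    split_ifs with h
    · subst h
      have htop : annihilatedBy r ((0 : degreeLT F j) : F[X]) a b = ⊤ :=
        eq_top_iff.2 fun S _ x _ _ => by simp [shiftAct]
      rw [htop, Nat.card_congr Submodule.topEquiv.toEquiv]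
      simp
    · have hc : (c : F[X]) ≠ 0 := by simpa using h
      have hdeg := mem_degreeLT.1 c.2
      rw [← natDegree_lt_iff_degree_lt hc] at hdeg
      have := card_annihilatedBy_mul hc ha hb (r := r) (by omega)
      rw [zpow_sub₀ hq, eq_div_iff (by simp), zpow_natCast, zpow_natCast]
      exact_mod_cast this
  simp only [h1]
  rw [Finset.sum_comm]
  simp only [h2]
  rw [← Finset.add_sum_erase _ _ (Finset.mem_univ 0), if_pos rfl,
    Finset.sum_congr rfl fun c hc => if_neg (Finset.ne_of_mem_erase hc), Finset.sum_const,
    Finset.card_erase_of_mem (Finset.mem_univ _), Finset.card_univ,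
    ← Nat.card_eq_fintype_card (α := degreeLT F j), card_degreeLT, nsmul_eq_mul,
    Nat.cast_sub (Nat.one_le_pow _ _ Fintype.card_pos)]
  simp

/-- The sequences of length `r` whose number wall vanishes on the `l × l` square with top left
corner in row `m` and column `n`. -/
def squareSeqs (F : Type*) [Field F] (r m : ℕ) (n : ℤ) (l : ℕ) : Set (Fin r → F) :=
  {S | Annihilated (zeroExtend F r S) m n l}

/-- By `card_annihilators_succ`, the number of annihilators minus `q` times that for the next
smaller space is `0` when the square vanishes and `1 - q` otherwise. Summing over all sequences and
evaluating both totals by `sum_card_annihilators` isolates the count. -/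
theorem ncard_squareSeqs [Fintype F] {r m l : ℕ} {n : ℤ} (hl : 0 < l) (h1 : 1 ≤ n - m)
    (h2 : n + l + m ≤ r + 1) :
    ((squareSeqs F r m n l).ncard : ℚ) = (Fintype.card F : ℚ) ^ ((r : ℤ) - l) := by
  classical
  have hq : (Fintype.card F : ℚ) ≠ 0 := by simp
  have hq1 : (Fintype.card F : ℚ) - 1 ≠ 0 := by
    have : (1 : ℚ) < Fintype.card F := by exact_mod_cast Fintype.one_lt_card
    linarith
  have e1 := sum_card_annihilators (F := F) (r := r) (j := m + 1) (k := m + l) (a := n - m)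
    (b := n + l) h1 (by push_cast; ring) (by push_cast; omega)
  have e2 := sum_card_annihilators (F := F) (r := r) (j := m) (k := m + l + 1) (a := n - m)
    (b := n + l + 1) h1 (by push_cast; ring) (by omega)
  have e3 : ∀ S : Fin r → F,
      (Nat.card (annihilators (zeroExtend F r S) (m + 1) (n - m) (n + l)) : ℚ) -
        Fintype.card F * Nat.card (annihilators (zeroExtend F r S) m (n - m) (n + l + 1)) =
      (1 - Fintype.card F) - (1 - Fintype.card F) * if S ∈ squareSeqs F r m n l then 1 else 0 := by
    intro S
    split_ifs with h
    · rw [card_annihilators_succ (by omega) (annihilated_iff_annihilators_ne_bot.1 h)]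
      push_cast; ring
    · have h0 : annihilators (zeroExtend F r S) (m + 1) (n - m) (n + l) = ⊥ := by
        by_contra h'
        exact h (annihilated_iff_annihilators_ne_bot.2 h')
      have h0' : annihilators (zeroExtend F r S) m (n - m) (n + l + 1) = ⊥ := by
        rw [eq_bot_iff, ← h0]
        exact fun d hd => ⟨degreeLT_mono (by omega) hd.1, fun x h1 h2 => hd.2 x h1 (by omega)⟩
      rw [h0, h0']
      simp
  have e4 := Finset.sum_congr rfl fun S (_ : S ∈ Finset.univ) => e3 S
  rw [Finset.sum_sub_distrib, ← Finset.mul_sum, e1, e2, Finset.sum_sub_distrib, ← Finset.mul_sum,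
    Finset.sum_boole] at e4
  rw [Set.ncard_eq_toFinset_card', ← Set.filter_mem_univ_eq_toFinset]
  have z1 : (Fintype.card F : ℚ) ^ ((r : ℤ) - (m + l : ℕ)) * (Fintype.card F : ℚ) ^ m =
      (Fintype.card F : ℚ) ^ ((r : ℤ) - l) := by
    rw [← zpow_natCast, ← zpow_add₀ hq]; congr 1; push_cast; ring
  have z2 : (Fintype.card F : ℚ) * (Fintype.card F : ℚ) ^ ((r : ℤ) - (m + l + 1 : ℕ)) =
      (Fintype.card F : ℚ) ^ ((r : ℤ) - (m + l : ℕ)) := by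
    rw [← zpow_one_add₀ hq]; congr 1; push_cast; ring
  simp only [Finset.sum_const, Finset.card_univ, Fintype.card_fun, Fintype.card_fin,
    nsmul_eq_mul, Nat.cast_pow] at e4
  apply mul_left_cancel₀ hq1
  linear_combination -e4 - ((Fintype.card F : ℚ) ^ m - 1) * z2 + (Fintype.card F - 1 : ℚ) * z1

end Counting

/-! ### Inclusion-exclusion for neighbouring squares -/

theorem ncard_union_eq {F : Type*} [Finite F] {r : ℕ} (A B : Set (Fin r → F)) :
    ((A ∪ B).ncard : ℚ) = A.ncard + B.ncard - ((A ∩ B).ncard : ℚ) := by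
  have := Set.ncard_union_add_ncard_inter A B
  rw [eq_sub_iff_add_eq]
  exact_mod_cast this

section InclusionExclusion

variable {F : Type*} [Field F]

theorem mem_squareSeqs {r m l : ℕ} {n : ℤ} {S : Fin r → F} :
    S ∈ squareSeqs F r m n l ↔ Annihilated (zeroExtend F r S) m n l := Iff.rfl

theorem squareSeqs_inter_succ_row {r m l : ℕ} {n : ℤ} (hl : 0 < l) :
    squareSeqs F r m n l ∩ squareSeqs F r (m + 1) n l =
      squareSeqs F r m n (l + 1) ∪ squareSeqs F r m (n - 1) (l + 1) := by
  ext S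
  simp only [Set.mem_inter_iff, Set.mem_union, mem_squareSeqs]
  constructor
  · rintro ⟨h0, h1⟩
    obtain ⟨j, hj, h⟩ := exists_annihilated_of_tall (δ := 1) hl fun i hi => by
      interval_cases i
      exacts [h0, h1]
    interval_cases j
    · exact Or.inl (by simpa using h)
    · exact Or.inr (by simpa using h)
  · rintro (h | h) <;> constructor <;>
      exact h.subsquare (by omega) (by omega) (by omega) (by push_cast; omega)

/-- In row `0` the square cannot start one row higher, so a single square remains; this starts the
recursion. -/
theorem squareSeqs_inter_pred_column_zero {r l : ℕ} {n : ℤ} (hl : 0 < l) :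
    squareSeqs F r 0 n l ∩ squareSeqs F r 0 (n - 1) l = squareSeqs F r 0 (n - 1) (l + 1) := by
  ext S
  simp only [Set.mem_inter_iff, mem_squareSeqs]
  constructor
  · rintro ⟨h0, h1⟩
    obtain ⟨i, -, hi, h⟩ := exists_annihilated_of_wide (d := 1) (n := n - 1) hl fun i hi => by
      interval_cases i
      exacts [by simpa using h1, by simpa using h0]
    obtain rfl : i = 0 := by omega
    exact h
  · intro h
    constructor <;> exact h.subsquare (by omega) (by omega) (by omega) (by push_cast; omega)

theorem squareSeqs_inter_pred_column_succ {r m l : ℕ} {n : ℤ} (hl : 0 < l) :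
    squareSeqs F r (m + 1) n l ∩ squareSeqs F r (m + 1) (n - 1) l =
      squareSeqs F r m (n - 1) (l + 1) ∪ squareSeqs F r (m + 1) (n - 1) (l + 1) := by
  ext S
  simp only [Set.mem_inter_iff, Set.mem_union, mem_squareSeqs]
  constructor
  · rintro ⟨h0, h1⟩
    obtain ⟨i, hi, -, h⟩ := exists_annihilated_of_wide (d := 1) (n := n - 1) hl fun i hi => by
      interval_cases i
      exacts [by simpa using h1, by simpa using h0]
    interval_cases i
    exacts [Or.inr h, Or.inl h]
  · rintro (h | h) <;> constructor <;>
      exact h.subsquare (by omega) (by omega) (by omega) (by push_cast; omega)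

variable [Fintype F]

/-- The pair of squares of side `l` in row `m + 1` becomes two squares of side `l + 1`, one above
the other; their common part is two squares of side `l + 2` side by side in row `m`, to which
induction applies. -/
theorem ncard_squareSeqs_inter_pred_column {r m l : ℕ} {n : ℤ} (hl : 0 < l) (h1 : 1 ≤ n - 1 - m)
    (h2 : n + l + m ≤ r + 1) :
    ((squareSeqs F r m n l ∩ squareSeqs F r m (n - 1) l).ncard : ℚ) =
      (Fintype.card F : ℚ) ^ ((r : ℤ) - l - 1 - 2 * m) / (Fintype.card F + 1) *
        (2 * (Fintype.card F : ℚ) ^ (2 * m + 1) - Fintype.card F + 1) := by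
  have hq : (Fintype.card F : ℚ) ≠ 0 := by simp
  have hq1 : (Fintype.card F : ℚ) + 1 ≠ 0 := by positivity
  induction m generalizing n l with
  | zero =>
    rw [squareSeqs_inter_pred_column_zero hl, ncard_squareSeqs (by omega) (by omega)
      (by push_cast; omega)]
    rw [show (r : ℤ) - (l + 1 : ℕ) = r - l - 1 - 2 * (0 : ℕ) by push_cast; ring]
    field_simp
    ring
  | succ m ih =>
    push_cast at h1 h2
    rw [squareSeqs_inter_pred_column_succ hl, ncard_union_eq,
      squareSeqs_inter_succ_row (by omega), ncard_union_eq,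
      ih (by omega) (by omega) (by push_cast; omega),
      ncard_squareSeqs (by omega) (by omega) (by push_cast; omega),
      ncard_squareSeqs (by omega) (by push_cast; omega) (by push_cast; omega),
      ncard_squareSeqs (by omega) (by omega) (by push_cast; omega),
      ncard_squareSeqs (by omega) (by omega) (by push_cast; omega)]
    -- Factoring out the lowest power leaves natural exponents, hence an identity of polynomials in
    -- `q`.
    obtain ⟨Y, hY⟩ : ∃ Y, Y = (Fintype.card F : ℚ) ^ ((r : ℤ) - l - 1 - 2 * (m + 1 : ℕ)) := ⟨_, rfl⟩
    have e (k : ℕ) : (Fintype.card F : ℚ) ^ ((r : ℤ) - l - 1 - 2 * (m + 1 : ℕ) + k) =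
        Y * (Fintype.card F : ℚ) ^ k := by rw [zpow_add₀ hq, hY, zpow_natCast]
    rw [← hY,
      show (r : ℤ) - (l + 1 + 1 : ℕ) - 1 - 2 * m = (r : ℤ) - l - 1 - 2 * (m + 1 : ℕ) + (0 : ℕ) by
        push_cast; ring,
      show (r : ℤ) - (l + 1 : ℕ) = (r : ℤ) - l - 1 - 2 * (m + 1 : ℕ) + (2 * m + 2 : ℕ) by
        push_cast; ring,
      show (r : ℤ) - (l + 1 + 1 : ℕ) = (r : ℤ) - l - 1 - 2 * (m + 1 : ℕ) + (2 * m + 1 : ℕ) by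
        push_cast; ring,
e, e, e]
    field_simp
    ring

theorem ncard_squareSeqs_inter_succ_row {r m l : ℕ} {n : ℤ} (hl : 0 < l) (h1 : 1 ≤ n - 1 - m)
    (h2 : n + l + m ≤ r) :
    ((squareSeqs F r m n l ∩ squareSeqs F r (m + 1) n l).ncard : ℚ) =
      2 * (Fintype.card F : ℚ) ^ ((r : ℤ) - l - 1) -
      (Fintype.card F : ℚ) ^ ((r : ℤ) - l - 2 - 2 * m) / (Fintype.card F + 1) *
        (2 * (Fintype.card F : ℚ) ^ (2 * m + 1) - Fintype.card F + 1) := by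
  rw [squareSeqs_inter_succ_row hl, ncard_union_eq,
    ncard_squareSeqs_inter_pred_column (by omega) h1 (by push_cast; omega),
    ncard_squareSeqs (by omega) (by omega) (by push_cast; omega),
    ncard_squareSeqs (by omega) (by omega) (by push_cast; omega),
    show (r : ℤ) - (l + 1 : ℕ) = (r : ℤ) - l - 1 by push_cast; ring,
    show (r : ℤ) - l - 1 - 1 - 2 * m = (r : ℤ) - l - 2 - 2 * m by ring]
  ring

/-- The sequences with a zero rectangle of width `h - δ` and height `h`, rows `m, …, m + h - 1` and
columns `n, …, n + h - δ - 1`, as a union of zero squares. -/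
def tallSeqs (F : Type*) [Field F] (r m : ℕ) (n : ℤ) (h δ : ℕ) : Set (Fin r → F) :=
  {S | ∃ j ≤ δ, S ∈ squareSeqs F r m (n - j) h}

/-- The sequences with a zero rectangle of width `l` and height `l - d`, rows `m, …, m + l - d - 1`
and columns `n, …, n + l - 1`, as a union of zero squares. -/
def wideSeqs (F : Type*) [Field F] (r m : ℕ) (n : ℤ) (l d : ℕ) : Set (Fin r → F) :=
  {S | ∃ i ≤ d, S ∈ squareSeqs F r (m - i) n l}

theorem tallSeqs_zero {F : Type*} [Field F] (r m : ℕ) (n : ℤ) (h : ℕ) :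
    tallSeqs F r m n h 0 = squareSeqs F r m n h := by
  ext S; simp [tallSeqs]

theorem wideSeqs_zero {F : Type*} [Field F] (r m : ℕ) (n : ℤ) (l : ℕ) :
    wideSeqs F r m n l 0 = squareSeqs F r m n l := by
  ext S; simp [wideSeqs]

theorem tallSeqs_succ {F : Type*} [Field F] (r m : ℕ) (n : ℤ) (h δ : ℕ) :
    tallSeqs F r m n h (δ + 1) =
      tallSeqs F r m n h δ ∪ squareSeqs F r m (n - δ - 1) h := by
  ext S
  simp only [tallSeqs, Set.mem_union, Set.mem_ofPred_eq]
  constructor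
  · rintro ⟨j, hj, hS⟩
    rcases hj.eq_or_lt with rfl | hj
    · right; rwa [sub_sub, ← Nat.cast_succ]
    · exact Or.inl ⟨j, by omega, hS⟩
  · rintro (⟨j, hj, hS⟩ | hS)
    · exact ⟨j, by omega, hS⟩
    · exact ⟨δ + 1, le_rfl, by rwa [Nat.cast_succ, ← sub_sub]⟩

theorem wideSeqs_succ {F : Type*} [Field F] (r m : ℕ) (n : ℤ) (l d : ℕ) :
    wideSeqs F r m n l (d + 1) =
      wideSeqs F r m n l d ∪ squareSeqs F r (m - d - 1) n l := by
  ext S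
  simp only [wideSeqs, Set.mem_union, Set.mem_ofPred_eq]
  constructor
  · rintro ⟨j, hj, hS⟩
    rcases hj.eq_or_lt with rfl | hj
    · exact Or.inr hS
    · exact Or.inl ⟨j, by omega, hS⟩
  · rintro (⟨j, hj, hS⟩ | hS)
    · exact ⟨j, by omega, hS⟩
    · exact ⟨d + 1, le_rfl, hS⟩

/-- On the diagonal of the neighbouring square at column `n - δ`, all places but the last lie in the
new square, and the last lies in the bottom row of any earlier one. `wideSeqs_inter` uses the same
diagonal argument. -/
theorem tallSeqs_inter {F : Type*} [Field F] {r m h δ : ℕ} {n : ℤ} (hδ : δ + 1 < h) :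
    tallSeqs F r m n h δ ∩ squareSeqs F r m (n - δ - 1) h =
      squareSeqs F r m (n - δ) h ∩ squareSeqs F r m (n - δ - 1) h := by
  ext S
  simp only [Set.mem_inter_iff, and_congr_left_iff]
  refine fun hS => ⟨?_, fun h => ⟨δ, le_rfl, h⟩⟩
  rintro ⟨j, hj, hS'⟩
  obtain ⟨h, rfl⟩ : ∃ k, h = k + 1 := ⟨h - 1, by omega⟩
  rw [mem_squareSeqs] at *
  refine annihilated_of_diagonal fun k hk => ?_
  rcases lt_or_ge k h with hkh | hkh
  · exact hS.subsquare (by omega) (by omega) (by omega) (by push_cast; omega)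
  · exact hS'.subsquare (by omega) (by omega) (by omega) (by push_cast; omega)

theorem wideSeqs_inter {F : Type*} [Field F] {r m l d : ℕ} {n : ℤ} (hd : d + 1 < l)
    (hm : d + 1 ≤ m) :
    wideSeqs F r m n l d ∩ squareSeqs F r (m - d - 1) n l =
      squareSeqs F r (m - d - 1) n l ∩ squareSeqs F r (m - d - 1 + 1) n l := by
  ext S
  rw [Set.inter_comm]
  simp only [Set.mem_inter_iff, and_congr_right_iff]
  refine fun hS => ⟨?_, fun h => ⟨d, le_rfl, by rwa [show m - d - 1 + 1 = m - d by omega] at h⟩⟩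
  rintro ⟨j, hj, hS'⟩
  obtain ⟨l, rfl⟩ : ∃ k, l = k + 1 := ⟨l - 1, by omega⟩
  rw [mem_squareSeqs] at *
  refine annihilated_of_diagonal fun k hk => ?_
  rcases lt_or_ge k l with hkh | hkh
  · exact hS.subsquare (by omega) (by omega) (by omega) (by push_cast; omega)
  · exact hS'.subsquare (by omega) (by omega) (by omega) (by push_cast; omega)

theorem ncard_tallSeqs {r m h δ : ℕ} {n : ℤ} (hδ : δ < h) (h1 : 1 ≤ n - δ - m)
    (h2 : n + h + m ≤ r + 1) :
    ((tallSeqs F r m n h δ).ncard : ℚ) =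
      (Fintype.card F : ℚ) ^ ((r : ℤ) - h - 2 * m - 1) / (Fintype.card F + 1) *
        ((δ + 1) * (Fintype.card F : ℚ) ^ (2 * m + 2) - (δ - 1) * (Fintype.card F : ℚ) ^ (2 * m + 1)
          + δ * (Fintype.card F - 1)) := by
  have hq : (Fintype.card F : ℚ) ≠ 0 := by simp
  have hq1 : (Fintype.card F : ℚ) + 1 ≠ 0 := by positivity
  have e : (Fintype.card F : ℚ) ^ ((r : ℤ) - h) =
      (Fintype.card F : ℚ) ^ ((r : ℤ) - h - 2 * m - 1) * (Fintype.card F : ℚ) ^ (2 * m + 1) := by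
    rw [← zpow_natCast, ← zpow_add₀ hq]; congr 1; push_cast; ring
  induction δ with
  | zero =>
    rw [tallSeqs_zero, ncard_squareSeqs hδ (by simpa using h1) h2, e]
    field_simp
    push_cast
    ring
  | succ δ ih =>
    push_cast at h1
    rw [tallSeqs_succ, ncard_union_eq, tallSeqs_inter hδ, ih (by omega) (by omega),
      ncard_squareSeqs (by omega) (by omega) (by omega),
      ncard_squareSeqs_inter_pred_column (by omega) (by omega) (by omega), e,
      show (r : ℤ) - h - 1 - 2 * m = (r : ℤ) - h - 2 * m - 1 by ring]
    field_simp
    push_cast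
    ring

theorem ncard_wideSeqs {r m l d : ℕ} {n : ℤ} (hd : d < l) (hm : d ≤ m) (h1 : 1 ≤ n - m)
    (h2 : n + l + m ≤ r + 1) :
    ((wideSeqs F r m n l d).ncard : ℚ) =
      (Fintype.card F : ℚ) ^ ((r : ℤ) - l - 2 * m) / (Fintype.card F + 1) ^ 2 *
        ((d + 1) * (Fintype.card F : ℚ) ^ (2 * m + 2) + 2 * (Fintype.card F : ℚ) ^ (2 * m + 1)
          - (d - 1) * (Fintype.card F : ℚ) ^ (2 * m) - (Fintype.card F : ℚ) ^ (2 * d) + 1) := by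
  have hq : (Fintype.card F : ℚ) ≠ 0 := by simp
  have hq1 : (Fintype.card F : ℚ) + 1 ≠ 0 := by positivity
  have e (k : ℕ) : (Fintype.card F : ℚ) ^ ((r : ℤ) - l - 2 * m + k) =
      (Fintype.card F : ℚ) ^ ((r : ℤ) - l - 2 * m) * (Fintype.card F : ℚ) ^ k := by
    rw [zpow_add₀ hq, zpow_natCast]
  have e0 : (r : ℤ) - l = r - l - 2 * m + (2 * m : ℕ) := by push_cast; ring
  induction d with
  | zero =>
    rw [wideSeqs_zero, ncard_squareSeqs hd h1 h2, e0, e]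
    field_simp
    push_cast
    ring_nf
  | succ d ih =>
    rw [wideSeqs_succ, ncard_union_eq, wideSeqs_inter hd hm, ih (by omega) (by omega),
      ncard_squareSeqs (by omega) (by omega) (by omega),
      ncard_squareSeqs_inter_succ_row (by omega) (by omega) (by omega)]
    -- `k` is the starting row of the new square; this removes the truncated subtraction.
    obtain ⟨k, rfl⟩ : ∃ k, m = k + d + 1 := ⟨m - d - 1, by omega⟩
    rw [show k + d + 1 - d - 1 = k by omega,
      show (r : ℤ) - l - 1 = r - l - 2 * (k + d + 1 : ℕ) + (2 * k + 2 * d + 1 : ℕ) by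
        push_cast; ring,
      show (r : ℤ) - l - 2 - 2 * k = r - l - 2 * (k + d + 1 : ℕ) + (2 * d : ℕ) by
        push_cast; ring, e, e]
    rw [show (Fintype.card F : ℚ) ^ ((r : ℤ) - l) =
      (Fintype.card F : ℚ) ^ ((r : ℤ) - l - 2 * (k + d + 1 : ℕ)) *
      (Fintype.card F : ℚ) ^ (2 * (k + d + 1)) from by rw [← e, ← e0]]
    field_simp
    push_cast
    ring

theorem ncard_tallSeqs_le {r m h δ : ℕ} {n : ℤ} (hδ : δ < h) (h1 : 1 ≤ n - δ - m)
    (h2 : n + h + m ≤ r + 1) :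
    ((tallSeqs F r m n h δ).ncard : ℚ) ≤ (δ + 1) * (Fintype.card F : ℚ) ^ ((r : ℤ) - h) := by
  induction δ with
  | zero => rw [tallSeqs_zero, ncard_squareSeqs hδ (by simpa using h1) h2]; simp
  | succ δ ih =>
    push_cast at h1
    have := ih (by omega) (by omega)
    rw [tallSeqs_succ, ncard_union_eq, ncard_squareSeqs (by omega) (by omega) (by omega)]
    push_cast
    linarith [Nat.cast_nonneg (α := ℚ)
      (tallSeqs F r m n h δ ∩ squareSeqs F r m (n - δ - 1) h).ncard]

theorem ncard_wideSeqs_le {r m l d : ℕ} {n : ℤ} (hd : d < l) (hm : d ≤ m) (h1 : 1 ≤ n - m)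
    (h2 : n + l + m ≤ r + 1) :
    ((wideSeqs F r m n l d).ncard : ℚ) ≤ (d + 1) * (Fintype.card F : ℚ) ^ ((r : ℤ) - l) := by
  induction d with
  | zero => rw [wideSeqs_zero, ncard_squareSeqs hd h1 h2]; simp
  | succ d ih =>
    have := ih (by omega) (by omega)
    rw [wideSeqs_succ, ncard_union_eq, ncard_squareSeqs (by omega) (by omega) (by omega)]
    push_cast
    linarith [Nat.cast_nonneg (α := ℚ)
      (wideSeqs F r m n l d ∩ squareSeqs F r (m - d - 1) n l).ncard]

end InclusionExclusion

/-! ### From rectangles to unions of squares -/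

section Rectangles

variable {F : Type*} [Field F]

theorem HasZeroRect.exists_annihilated {r l n m : ℕ} {d : ℤ} {S : Fin r → F}
    (h : HasZeroRect S l d n m) : ∃ T : ℤ → F, ExtendsSeq T S ∧ ∀ (i : ℕ) (j : ℤ),
      m ≤ i → i < m + (l - d) → n ≤ j → j < n + l → Annihilated T i j 1 := by
  obtain ⟨T, hT, h⟩ := h
  exact ⟨T, hT, fun i j h1 h2 h3 h4 =>
    (numberWall_eq_zero_iff T i j).1 (h i j ⟨by exact_mod_cast h1, h2, h3, h4⟩)⟩

/-- A zero square involves only the terms `n - m, …, n + l + m - 1`, those of its top row. Its lower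
part may therefore leave the finite wall, and the chosen extension does not matter. -/
theorem Annihilated.of_extendsSeq {r m l : ℕ} {n : ℤ} {S : Fin r → F} {T : ℤ → F}
    (h : Annihilated T m n l) (hT : ExtendsSeq T S) (h1 : 1 ≤ n - m) (h2 : n + l + m ≤ r + 1) :
    Annihilated (zeroExtend F r S) m n l :=
  h.congr fun y h3 h4 => hT.eq_zeroExtend (by omega) (by omega)

theorem hasZeroRect_of_squareSeqs {r l n m m' l' : ℕ} {d n' : ℤ} {S : Fin r → F}
    (h : S ∈ squareSeqs F r m' n' l') (h1 : m' ≤ m) (h2 : m + (l - d) ≤ m' + l') (h3 : n' ≤ n)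
    (h4 : (n : ℤ) + l ≤ n' + l') : HasZeroRect S l d n m := by
  refine ⟨_, extendsSeq_zeroExtend S, fun i j ⟨h5, h6, h7, h8⟩ => ?_⟩
  lift i to ℕ using by omega
  rw [numberWall_eq_zero_iff]
  exact Annihilated.subsquare h (by omega) (by omega) (by omega) (by push_cast; omega)

theorem rectSeqs_eq_tallSeqs {r l δ n m : ℕ} (hl : 0 < l) (h1 : (1 : ℤ) ≤ n - δ - m)
    (h2 : n + (l + δ) + m ≤ r + 1) :
    rectSeqs F r l (-δ) n m = tallSeqs F r m n (l + δ) δ := by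
  ext S
  constructor
  · intro h
    obtain ⟨T, hT, h⟩ := HasZeroRect.exists_annihilated h
    obtain ⟨j, hj, h⟩ := exists_annihilated_of_tall (m := m) (n := n) (δ := δ) hl fun i hi => by
      obtain ⟨k, rfl⟩ : ∃ k, l = k + 1 := ⟨l - 1, by omega⟩
      exact annihilated_of_diagonal fun k hk =>
        h _ _ (by omega) (by push_cast; omega) (by omega) (by push_cast; omega)
    exact ⟨j, hj, h.of_extendsSeq hT (by omega) (by push_cast; omega)⟩
  · rintro ⟨j, hj, h⟩
    exact hasZeroRect_of_squareSeqs h (by omega) (by push_cast; omega) (by omega)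
      (by push_cast; omega)

/-- The square may start at most `d` rows above the rectangle, but not above row `0`, whence `min d
m`. -/
theorem rectSeqs_eq_wideSeqs {r l d n m : ℕ} (hd : d < l) (h1 : 1 + m ≤ n)
    (h2 : n + l + m ≤ r + 1) :
    rectSeqs F r l d n m = wideSeqs F r m n l (min d m) := by
  ext S
  constructor
  · intro h
    obtain ⟨T, hT, h⟩ := HasZeroRect.exists_annihilated h
    obtain ⟨k, rfl⟩ : ∃ k, l = k + 1 + d := ⟨l - d - 1, by omega⟩
    obtain ⟨i, hi, him, h⟩ := exists_annihilated_of_wide (m := m) (n := n) (d := d) (h := k + 1)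
      (by omega) fun i hi => annihilated_of_diagonal fun k hk =>
        h _ _ (by omega) (by push_cast; omega) (by omega) (by push_cast; omega)
    exact ⟨i, by omega, h.of_extendsSeq hT (by omega) (by push_cast; omega)⟩
  · rintro ⟨i, hi, h⟩
    exact hasZeroRect_of_squareSeqs h (by omega) (by omega) (by omega) (by omega)

/-- The wall narrows downwards, so each alternative puts the top corners of the rectangle on the
wall. -/
theorem LongestSideOnWall.of_nonneg {r l d n m : ℕ} (hl : d < l)
    (h : LongestSideOnWall r l d n m) : 1 + m ≤ n ∧ n + l + m ≤ r + 1 := by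
  rcases h with ⟨-, h | h⟩ | ⟨hd, h | h⟩
  · have a := h n le_rfl (by omega)
    have b := h (n + l - 1) (by omega) (by omega)
    simp only [OnFiniteWall] at a b
    omega
  · have a := h n le_rfl (by omega)
    have b := h (n + l - 1) (by omega) (by omega)
    simp only [OnFiniteWall] at a b
    omega
  · have a := h (m + (l - d) - 1) (by omega) (by omega)
    simp only [OnFiniteWall] at a
    omega
  · have a := h (m + (l - d) - 1) (by omega) (by omega)
    simp only [OnFiniteWall] at a
    omega

/-- The bottom end of a full column on the wall leaves room for the top rows of all squares of side
`l + δ` around the rectangle, from column `n - δ` to `n + l + δ - 1`. -/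
theorem LongestSideOnWall.of_nonpos {r l δ n m : ℕ} (hl : 0 < l)
    (h : LongestSideOnWall r l (-δ) n m) :
    (1 : ℤ) ≤ n - δ - m ∧ n + (l + δ) + m ≤ r + 1 := by
  rcases h with ⟨hd, h | h⟩ | ⟨hd, h | h⟩
  · have a := h n le_rfl (by omega)
    have b := h (n + l - 1) (by omega) (by omega)
    simp only [OnFiniteWall] at a b
    omega
  · have a := h n le_rfl (by omega)
    have b := h (n + l - 1) (by omega) (by omega)
    simp only [OnFiniteWall] at a b
    omega
  · have a := h (m + (l + δ) - 1) (by omega) (by omega)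
    simp only [OnFiniteWall] at a
    omega
  · have a := h (m + (l + δ) - 1) (by omega) (by omega)
    simp only [OnFiniteWall] at a
    omega

theorem ncard_rectSeqs_le [Fintype F] {r n m l : ℕ} {d : ℤ} (hl : 0 < l) (hd : d < l)
    (h : LongestSideOnWall r l d n m) :
    ((rectSeqs F r l d n m).ncard : ℚ) ≤
      2 * (max 1 |d| : ℤ) * (Fintype.card F : ℚ) ^ ((r : ℤ) - max (l : ℤ) (l - d)) := by
  rcases le_total 0 d with h0 | h0
  · lift d to ℕ using h0
    norm_cast at hd
    obtain ⟨h1, h2⟩ := h.of_nonneg hd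
    rw [rectSeqs_eq_wideSeqs hd h1 h2, max_eq_left (by omega : (l : ℤ) - d ≤ l)]
    refine (ncard_wideSeqs_le (by omega) (by omega) (by omega) (by omega)).trans ?_
    gcongr
    have : (min d m : ℤ) + 1 ≤ 2 * max 1 |(d : ℤ)| := by rw [Nat.abs_cast]; omega
    exact_mod_cast this
  · obtain ⟨δ, rfl⟩ : ∃ δ : ℕ, d = -δ := ⟨(-d).toNat, by omega⟩
    obtain ⟨h1, h2⟩ := h.of_nonpos hl
    rw [rectSeqs_eq_tallSeqs hl h1 h2, max_eq_right (by omega : (l : ℤ) ≤ l - -δ)]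
    refine (ncard_tallSeqs_le (by omega) h1 (by omega)).trans ?_
    rw [show (r : ℤ) - (l - -δ) = r - (l + δ : ℕ) by push_cast; ring]
    gcongr
    have : (δ : ℤ) + 1 ≤ 2 * max 1 |-(δ : ℤ)| := by rw [abs_neg, Nat.abs_cast]; omega
    exact_mod_cast this

end Rectangles

/-! ### The counting formulas and the uniform bound -/

theorem mainTheorem8 (q : ℕ) (hq : IsPrimePow q) :
    (∀ (F : Type u) [Field F] [Fintype F], Fintype.card F = q →
      ∀ (r n m l : ℕ) (d : ℤ), 0 < l → d < l → LongestSideOnWall r l d n m →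
        (d ≤ 0 →
          ((rectSeqs F r l d n m).ncard : ℚ) =
            (q : ℚ) ^ ((r : ℤ) - (l - d) - 2 * m - 1) / ((q : ℚ) + 1) *
              ((-d + 1) * (q : ℚ) ^ (2 * m + 2) - (-d - 1) * (q : ℚ) ^ (2 * m + 1)
                - d * ((q : ℚ) - 1))) ∧
        (0 ≤ d → d ≤ m →
          ((rectSeqs F r l d n m).ncard : ℚ) =
            (q : ℚ) ^ ((r : ℤ) - l - 2 * m) / ((q : ℚ) + 1) ^ 2 *
              ((d + 1) * (q : ℚ) ^ (2 * m + 2) + 2 * (q : ℚ) ^ (2 * m + 1)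
                - (d - 1) * (q : ℚ) ^ (2 * m) - (q : ℚ) ^ (2 * d) + 1)) ∧
        ((m : ℤ) < d →
          ((rectSeqs F r l d n m).ncard : ℚ) =
            (q : ℚ) ^ ((r : ℤ) - l - 2 * m) / ((q : ℚ) + 1) ^ 2 *
              (((m : ℚ) + 1) * (q : ℚ) ^ (2 * m + 2) + 2 * (q : ℚ) ^ (2 * m + 1)
                - ((m : ℚ) - 1) * (q : ℚ) ^ (2 * m) - (q : ℚ) ^ (2 * m) + 1))) ∧
    (∃ C : ℝ, 0 < C ∧
      ∀ (F : Type u) [Field F] [Fintype F], Fintype.card F = q →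
        ∀ (r n m l : ℕ) (d : ℤ), 0 < l → d < l → LongestSideOnWall r l d n m →
          ((rectSeqs F r l d n m).ncard : ℝ) ≤
            C * (max 1 |d| : ℤ) * (q : ℝ) ^ ((r : ℤ) - max (l : ℤ) (l - d))) := by
  -- The constant `2` comes from `|d| + 1 ≤ 2 * max 1 |d|`.
  refine ⟨?_, 2, two_pos, ?_⟩
  · rintro F _ _ rfl r n m l d hl hd h
    refine ⟨fun h0 => ?_, fun h0 hm => ?_, fun hm => ?_⟩
    · obtain ⟨δ, rfl⟩ : ∃ δ : ℕ, d = -δ := ⟨(-d).toNat, by omega⟩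
      obtain ⟨h1, h2⟩ := h.of_nonpos hl
      rw [rectSeqs_eq_tallSeqs hl h1 h2, ncard_tallSeqs (by omega) h1 (by omega)]
      push_cast
      rw [sub_neg_eq_add, neg_neg]
      ring
    · lift d to ℕ using h0
      norm_cast at hd hm
      obtain ⟨h1, h2⟩ := h.of_nonneg hd
      rw [rectSeqs_eq_wideSeqs hd h1 h2, min_eq_left hm,
        ncard_wideSeqs hd hm (by omega) (by omega)]
      norm_cast
    · lift d to ℕ using by omega
      norm_cast at hd hm
      obtain ⟨h1, h2⟩ := h.of_nonneg hd
      rw [rectSeqs_eq_wideSeqs hd h1 h2, min_eq_right hm.le,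
        ncard_wideSeqs (by omega) le_rfl (by omega) (by omega)]
  · rintro F _ _ rfl r n m l d hl hd h
    have := (Rat.cast_le (K := ℝ)).2 (ncard_rectSeqs_le (F := F) hl hd h)
    push_cast at this ⊢
    exact this
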